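/- Theorem 2.4. Let $A=\{a_1,a_2,\ldots\}\subset(0,\infty)$ be such that $$a_{n+1}-a_n\ge 1\quad\text{for all } n\ge 1\qquad\text{and}\qquad \lim_{n\to\infty}\frac{\log a_n}{n}=0.$$ Then there exists a Lebesgue measurable set $E\subset\mathbb{R}$ such that $$\lim_{t\to\infty}\lambda(E\cap[t,t+1])=1,$$ where $\lambda$ denotes Lebesgue measure, but $E$ does not contain any similar copy of $A$, that is, there are no $c,d\in\mathbb{R}$ with $c\ne 0$ and $cA+d=\{cx+d : x\in A\}\subset E$. -/

import Mathlib

open Filter Topology MeasureTheory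

/-- `T` is a similar copy of `S ⊆ ℝ`: it has the form `c S + d = {c x + d : x ∈ S}` with real
numbers `c ≠ 0` and `d` (reflections, that is negative `c`, are allowed). -/
def IsSimilarCopy (T S : Set ℝ) : Prop :=
  ∃ c d : ℝ, c ≠ 0 ∧ T = (fun x : ℝ => c * x + d) '' S

/-! Remove from $(0,\infty)$ bounded sets $F_k$, where $F_k$ meets every $cA+d$ with $1/(k+1)\le
c\le k+1$, $|d|\le k+1$ and has measure at most $2^{-k}$ in each unit interval. Copies with $c<0$
leave $(0,\infty)$ since $a_n\to\infty$.

To build such a set for a parameter $k$, cut $\mathbb{R}$ into cells of length $1/k$, each cell into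
$q$ subcells, and choose one subcell per cell. The first $M$ terms of a copy lie in distinct cells,
so a proportion $(1-1/q)^M$ of the choices misses it. A grid of $O(a_M)$ pairs $(c,d)$ approximates
all copies to within subcells, and $a_M(1-1/q)^M\to0$, so one choice hits every grid copy
(`exists_forall_pattern_hit`). Tripling the chosen subcells absorbs the rounding. -/

/-- Union bound: if few partial patterns are prescribed, each on at least `m` coordinates, some
function agrees with every pattern in at least one coordinate. -/
theorem exists_forall_pattern_hit {ι P β : Type*} [Fintype ι] [DecidableEq ι] [Fintype β]
    [DecidableEq β] [Nonempty β] (s : Finset P) (S : P → Finset ι) (g : P → ι → β) (m : ℕ)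
    (hm : ∀ p ∈ s, (S p).card = m)
    (hcard : s.card * (Fintype.card β - 1) ^ m < Fintype.card β ^ m) :
    ∃ f : ι → β, ∀ p ∈ s, ∃ i ∈ S p, f i = g p i := by
  classical
  by_contra! hcon
  let avoid : P → Finset (ι → β) := fun p =>
    Fintype.piFinset fun i => if i ∈ S p then Finset.univ.erase (g p i) else Finset.univ
  have hcover : (Finset.univ : Finset (ι → β)) ⊆ s.biUnion avoid := by
    intro f _
    obtain ⟨p, hp, hf⟩ := hcon f
    refine Finset.mem_biUnion.2 ⟨p, hp, Fintype.mem_piFinset.2 fun i => ?_⟩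
    split_ifs with hi
    · simpa using hf i hi
    · simp
  have havoid : ∀ p ∈ s, (avoid p).card * Fintype.card β ^ m =
      (Fintype.card β - 1) ^ m * Fintype.card β ^ Fintype.card ι := by
    intro p hp
    have h1 : (avoid p).card =
        (Fintype.card β - 1) ^ m * Fintype.card β ^ (Fintype.card ι - m) := by
      rw [Fintype.card_piFinset, ← Finset.prod_mul_prod_compl (S p)]
      congr 1
      · rw [Finset.prod_congr rfl (g := fun _ => Fintype.card β - 1), Finset.prod_const, hm p hp]
        intro i hi
        simp [hi, Finset.card_erase_of_mem]
      · rw [Finset.prod_congr rfl (g := fun _ => Fintype.card β), Finset.prod_const,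
          Finset.card_compl, hm p hp]
        intro i hi
        simp [Finset.mem_compl.1 hi]
    have hle : m ≤ Fintype.card ι := hm p hp ▸ Finset.card_le_univ _
    rw [h1, mul_assoc, ← pow_add, Nat.sub_add_cancel hle]
  have htot : Fintype.card β ^ Fintype.card ι ≤ ∑ p ∈ s, (avoid p).card := by
    calc Fintype.card β ^ Fintype.card ι = (Finset.univ : Finset (ι → β)).card := by simp
      _ ≤ (s.biUnion avoid).card := Finset.card_le_card hcover
      _ ≤ _ := Finset.card_biUnion_le
  have hpos : 0 < Fintype.card β ^ Fintype.card ι := pow_pos Fintype.card_pos _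
  have := calc Fintype.card β ^ Fintype.card ι * Fintype.card β ^ m
      ≤ (∑ p ∈ s, (avoid p).card) * Fintype.card β ^ m := Nat.mul_le_mul_right _ htot
    _ = (s.card * (Fintype.card β - 1) ^ m) * Fintype.card β ^ Fintype.card ι := by
      rw [Finset.sum_mul, Finset.sum_congr rfl havoid, Finset.sum_const, smul_eq_mul, mul_assoc]
    _ < Fintype.card β ^ m * Fintype.card β ^ Fintype.card ι :=
      Nat.mul_lt_mul_of_pos_right hcard hpos
  rw [mul_comm] at this
  exact lt_irrefl _ this

theorem tendsto_mul_pow_of_tendsto_log_div (a : ℕ → ℝ) (hpos : ∀ n, 0 < a n)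
    (hlog : Tendsto (fun n : ℕ => Real.log (a n) / ((n : ℝ) + 1)) atTop (𝓝 0))
    {r : ℝ} (hr0 : 0 < r) (hr1 : r < 1) : Tendsto (fun n => a n * r ^ n) atTop (𝓝 0) := by
  -- Half the decay rate of $r^n=e^{-2\varepsilon n}$, so that growth $e^{\varepsilon(n+1)}$ still
  -- loses.
  have hε : 0 < -Real.log r / 2 := by linarith [Real.log_neg hr0 hr1]
  set ε := -Real.log r / 2 with hε_def
  have hgeom : Tendsto (fun n : ℕ => Real.exp ε * Real.exp (-ε) ^ n) atTop (𝓝 0) := by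
    simpa using (tendsto_pow_atTop_nhds_zero_of_lt_one (Real.exp_pos _).le
      (by simpa using hε : Real.exp (-ε) < 1)).const_mul (Real.exp ε)
  refine squeeze_zero' (Eventually.of_forall fun n => by have := hpos n; positivity) ?_ hgeom
  filter_upwards [hlog.eventually_lt_const hε] with n hn
  have hn' : Real.log (a n) < ε * (n + 1) := (div_lt_iff₀ (by positivity)).1 hn
  have hr : r = Real.exp (-(2 * ε)) := by
    rw [hε_def, ← Real.exp_log hr0]
    congr 1
    rw [Real.log_exp]
    ring
  rw [← Real.exp_log (hpos n), hr, ← Real.exp_nat_mul, ← Real.exp_nat_mul, ← Real.exp_add,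
    ← Real.exp_add, Real.exp_le_exp]
  linarith

/-- Supplies the count for the union bound: the first two factors are the numbers of grid dilations
and translations. -/
theorem exists_grid_card_lt (a : ℕ → ℝ) (hpos : ∀ n, 0 < a n)
    (hlog : Tendsto (fun n : ℕ => Real.log (a n) / ((n : ℝ) + 1)) atTop (𝓝 0))
    (A B q : ℕ) (hq : 2 ≤ q) :
    ∃ M : ℕ, (⌊A * a M⌋₊ + 1) * B * (q - 1) ^ M < q ^ M := by
  have hq' : (2 : ℝ) ≤ q := by exact_mod_cast hq
  set r : ℝ := (q - 1) / q with hr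
  have hr0 : 0 < r := div_pos (by linarith) (by linarith)
  have hr1 : r < 1 := (div_lt_one (by linarith)).2 (by linarith)
  have h := (((tendsto_mul_pow_of_tendsto_log_div a hpos hlog hr0 hr1).const_mul (A : ℝ)).add
    (tendsto_pow_atTop_nhds_zero_of_lt_one hr0.le hr1)).mul_const (B : ℝ)
  simp only [mul_zero, add_zero, zero_mul] at h
  obtain ⟨M, hM⟩ := (h.eventually_lt_const one_pos).exists
  refine ⟨M, ?_⟩
  have hqM : (0 : ℝ) < (q : ℝ) ^ M := by positivity
  have hfl : (⌊A * a M⌋₊ : ℝ) ≤ A * a M := Nat.floor_le (by have := hpos M; positivity)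
  have hrM : r ^ M * q ^ M = (q - 1) ^ M := by
    rw [← mul_pow, hr, div_mul_cancel₀ _ (by positivity)]
  have hq1 : (0 : ℝ) ≤ ((q : ℝ) - 1) ^ M := pow_nonneg (by linarith) _
  have : ((⌊A * a M⌋₊ : ℝ) + 1) * B * ((q : ℝ) - 1) ^ M < (q : ℝ) ^ M := by
    calc ((⌊A * a M⌋₊ : ℝ) + 1) * B * ((q : ℝ) - 1) ^ M
        ≤ (A * a M + 1) * B * ((q : ℝ) - 1) ^ M := by gcongr
      _ = ((A * (a M * r ^ M) + r ^ M) * B) * q ^ M := by rw [← hrM]; ring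
      _ < 1 * q ^ M := by gcongr
      _ = _ := one_mul _
  have hcast : ((q - 1 : ℕ) : ℝ) = (q : ℝ) - 1 := by
    rw [Nat.cast_sub (by omega)]; simp
  rw [← hcast] at this
  exact_mod_cast this

/-- Half-open intervals of length `3 / (k q)`, one starting in each of finitely many of the cells
`[z / k, (z + 1) / k)`, have small measure in every unit interval. -/
theorem volume_cellUnion_inter_Icc_le (k q : ℕ) (hk : 1 ≤ k) (hq : 1 ≤ q) (C : Set ℤ) (f : ℤ → ℤ)
    (hf0 : ∀ z, 0 ≤ f z) (hfq : ∀ z, f z < q) (t : ℝ) :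
    volume ((⋃ z ∈ C, Set.Ico (((z * q + f z : ℤ) : ℝ) / (k * q))
      (((z * q + f z + 3 : ℤ) : ℝ) / (k * q))) ∩ Set.Icc t (t + 1)) ≤ ENNReal.ofReal (18 / q) := by
  have hk' : (1 : ℝ) ≤ k := by exact_mod_cast hk
  have hq' : (1 : ℝ) ≤ q := by exact_mod_cast hq
  have hkq : (0 : ℝ) < k * q := by positivity
  set I : ℤ → Set ℝ := fun z => Set.Ico (((z * q + f z : ℤ) : ℝ) / (k * q))
      (((z * q + f z + 3 : ℤ) : ℝ) / (k * q)) with hI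
  -- An interval ends less than $4/k$ after its cell begins, because $f(z)+3<q+3\le 4q$. Hence at
  -- most $k+5\le 6k$ cells matter, which gives $18/q$.
  set D : Finset ℤ := Finset.Icc (⌊k * t⌋ - 4) (⌊k * t⌋ + k) with hD
  have hsub : (⋃ z ∈ C, I z) ∩ Set.Icc t (t + 1) ⊆ ⋃ z ∈ D, I z := by
    rintro x ⟨hx, hxt⟩
    obtain ⟨z, -, hz⟩ := Set.mem_iUnion₂.1 hx
    refine Set.mem_iUnion₂.2 ⟨z, ?_, hz⟩
    obtain ⟨h1, h2⟩ := hz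
    rw [div_le_iff₀ hkq] at h1
    rw [lt_div_iff₀ hkq] at h2
    have hf0' : (0 : ℝ) ≤ f z := by exact_mod_cast hf0 z
    have hfq' : (f z : ℝ) < q := by exact_mod_cast hfq z
    push_cast at h1 h2
    have e1 : (z : ℝ) ≤ k * t + k := by
      have : (z : ℝ) * q ≤ (k * t + k) * q := by nlinarith [hxt.2]
      exact le_of_mul_le_mul_right this (by positivity)
    have e2 : k * t < (z : ℝ) + 4 := by
      have : k * t * q < ((z : ℝ) + 4) * q := by nlinarith [hxt.1]
      exact lt_of_mul_lt_mul_right this (by positivity)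
    rw [hD, Finset.mem_Icc]
    constructor
    · have : ⌊k * t⌋ < z + 4 := Int.floor_lt.2 (by exact_mod_cast e2)
      omega
    · have : z - k ≤ ⌊k * t⌋ := Int.le_floor.2 (by push_cast; linarith)
      omega
  have hvol : ∀ z, volume (I z) = ENNReal.ofReal (3 / (k * q)) := by
    intro z
    rw [hI, Real.volume_Ico]
    congr 1
    push_cast
    field_simp
    ring
  have hDc : (D.card : ℝ) = k + 5 := by
    rw [hD, Int.card_Icc]
    have : (⌊k * t⌋ + k + 1 - (⌊k * t⌋ - 4)).toNat = k + 5 := by omega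
    rw [this]
    push_cast
    ring
  calc volume ((⋃ z ∈ C, I z) ∩ Set.Icc t (t + 1)) ≤ volume (⋃ z ∈ D, I z) := measure_mono hsub
    _ ≤ ∑ z ∈ D, volume (I z) := measure_biUnion_finset_le _ _
    _ = ENNReal.ofReal ((k + 5) * (3 / (k * q))) := by
      rw [Finset.sum_congr rfl fun z _ => hvol z, Finset.sum_const, nsmul_eq_mul, ← hDc,
        ENNReal.ofReal_mul (by positivity), ENNReal.ofReal_natCast]
    _ ≤ ENNReal.ofReal (18 / q) := by
      apply ENNReal.ofReal_le_ofReal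
      rw [mul_div_assoc', div_le_div_iff₀ hkq (by positivity)]
      nlinarith

theorem exists_bounded_sparse_hitting_of_nat (a : ℕ → ℝ) (hpos : ∀ n, 0 < a n)
    (hgap : ∀ n, 1 ≤ a (n + 1) - a n)
    (hlog : Tendsto (fun n : ℕ => Real.log (a n) / ((n : ℝ) + 1)) atTop (𝓝 0))
    (k q : ℕ) (hk : 1 ≤ k) (hq : 2 ≤ q) :
    ∃ F : Set ℝ, MeasurableSet F ∧ BddAbove F ∧
      (∀ t, volume (F ∩ Set.Icc t (t + 1)) ≤ ENNReal.ofReal (18 / q)) ∧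
      ∀ c d : ℝ, 1 / (k : ℝ) ≤ c → c ≤ k → -(k : ℝ) ≤ d → d ≤ k → ∃ n, c * a n + d ∈ F := by
  classical
  have hk' : (1 : ℝ) ≤ k := by exact_mod_cast hk
  have hq' : (2 : ℝ) ≤ q := by exact_mod_cast hq
  have hkq : (0 : ℝ) < k * q := by positivity
  have hmono : Monotone a := monotone_nat_of_le_succ fun n => by linarith [hgap n]
  obtain ⟨M, hM⟩ := exists_grid_card_lt a hpos hlog (k * (k * q)) (2 * k * (k * q) + 1) q hq
  set I := ⌊((k * (k * q) : ℕ) : ℝ) * a M⌋₊ + 1 with hI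
  set J := 2 * k * (k * q) + 1 with hJ
  -- the grid points `(c', d')` and the integer position of `c' * a n + d'`
  let x : ℕ × ℕ → ℕ → ℝ := fun p n =>
    (1 / k + p.1 / (k * q * a M)) * a n + (-k + p.2 / (k * q))
  let u : ℕ × ℕ → ℕ → ℤ := fun p n => ⌊k * q * x p n⌋
  -- Dilations are at least $1/k$ and gaps at least $1$, so consecutive terms are at least $q$
  -- subcells apart.
  have hu : ∀ p n, u p n + q ≤ u p (n + 1) := by
    intro p n
    apply Int.le_floor.2
    have h1 : (u p n : ℝ) ≤ k * q * x p n := Int.floor_le _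
    have h2 : 1 / (k : ℝ) ≤ x p (n + 1) - x p n := by
      have : x p (n + 1) - x p n = (1 / k + p.1 / (k * q * a M)) * (a (n + 1) - a n) := by
        simp only [x]; ring
      rw [this]
      have h3 : (0 : ℝ) ≤ p.1 / (k * q * a M) := by have := hpos M; positivity
      have h4 : (0 : ℝ) ≤ 1 / k := by positivity
      nlinarith [hgap n]
    have h3 : (q : ℝ) = k * q * (1 / k) := by field_simp
    have h4 := mul_le_mul_of_nonneg_left h2 hkq.le
    push_cast
    nlinarith
  have hcell : ∀ p, StrictMono fun n => u p n / (q : ℤ) := by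
    intro p
    apply strictMono_nat_of_lt_succ
    intro n
    have hq0 : (0 : ℤ) < q := by omega
    calc u p n / (q : ℤ) < u p n / (q : ℤ) + 1 := lt_add_one _
      _ = (u p n + q) / (q : ℤ) := by rw [Int.add_ediv_of_dvd_right dvd_rfl, Int.ediv_self hq0.ne']
      _ ≤ _ := Int.ediv_le_ediv hq0 (hu p n)
  set P := Finset.range I ×ˢ Finset.range J with hP
  set C : Finset ℤ := P.biUnion fun p => (Finset.range M).image fun n => u p n / (q : ℤ) with hC
  have hmod : ∀ w : ℤ, (w % (q : ℤ)).toNat < q := fun w => by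
    have := Int.emod_lt_of_pos w (by omega : (0 : ℤ) < q)
    omega
  have : NeZero q := ⟨by omega⟩
  let S : ℕ × ℕ → Finset C := fun p =>
    ((Finset.range M).image fun n => u p n / (q : ℤ)).subtype (· ∈ C)
  have hcards : ∀ p ∈ P, (S p).card = M := by
    intro p hp
    rw [Finset.card_subtype, Finset.filter_true_of_mem,
      Finset.card_image_of_injective _ (hcell p).injective, Finset.card_range]
    intro z hz
    exact Finset.mem_biUnion.2 ⟨p, hp, hz⟩
  -- The subcell holding the term that falls in cell $z$; its index is recovered by injectivity.
  let g : ℕ × ℕ → C → Fin q := fun p z =>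
    ⟨(u p (Function.invFun (fun n => u p n / (q : ℤ)) z.1) % (q : ℤ)).toNat, hmod _⟩
  obtain ⟨f, hf⟩ := exists_forall_pattern_hit P S g M hcards (by
    rw [Fintype.card_fin, hP, Finset.card_product, Finset.card_range, Finset.card_range]
    exact hM)
  -- The value off `C` is arbitrary within $[0,q)$, as only cells in `C` are used.
  let F : ℤ → ℤ := fun z => if h : z ∈ C then (f ⟨z, h⟩ : ℕ) else 0
  have hF0 : ∀ z, 0 ≤ F z := fun z => by simp only [F]; split_ifs <;> omega
  have hFq : ∀ z, F z < q := fun z => by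
    simp only [F]
    split_ifs with h
    · exact_mod_cast (f ⟨z, h⟩).2
    · omega
  refine ⟨⋃ z ∈ (C : Set ℤ), Set.Ico (((z * q + F z : ℤ) : ℝ) / (k * q))
      (((z * q + F z + 3 : ℤ) : ℝ) / (k * q)), ?_, ?_, ?_, ?_⟩
  · exact C.measurableSet_biUnion fun _ _ => measurableSet_Ico
  · exact (C.finite_toSet.bddAbove_biUnion).2 fun _ _ => bddAbove_Ico
  · exact volume_cellUnion_inter_Icc_le k q hk (by omega) _ F hF0 hFq
  intro c d hc1 hc2 hd1 hd2
  have haM := hpos M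
  set i := ⌊(c - 1 / k) * (k * q * a M)⌋₊ with hi
  set j := ⌊(d + k) * (k * q)⌋₊ with hj
  have hi0 : 0 ≤ (c - 1 / k) * (k * q * a M) := mul_nonneg (by linarith) (by positivity)
  have hj0 : 0 ≤ (d + k) * (k * q) := mul_nonneg (by linarith) (by positivity)
  have hiI : i < I := by
    apply Nat.lt_succ_of_le
    apply Nat.floor_le_floor
    push_cast
    have : 0 ≤ 1 / (k : ℝ) := by positivity
    have : (c - 1 / k) * (k * q * a M) ≤ k * (k * q * a M) := by gcongr; linarith
    linarith
  have hjJ : j < J := by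
    apply Nat.lt_succ_of_le
    apply Nat.floor_le_of_le
    push_cast
    gcongr
    linarith
  have hpP : (i, j) ∈ P := by simp [hP, hiI, hjJ]
  obtain ⟨z, hzS, hfz⟩ := hf (i, j) hpP
  obtain ⟨n, hn, hnz⟩ := Finset.mem_image.1 (Finset.mem_subtype.1 hzS)
  have hinv : Function.invFun (fun n => u (i, j) n / (q : ℤ)) z.1 = n := by
    rw [← hnz]
    exact Function.leftInverse_invFun (hcell (i, j)).injective n
  have hFz : F z.1 = u (i, j) n % (q : ℤ) := by
    have h1 : F z.1 = ((f z : ℕ) : ℤ) := by simp [F]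
    rw [h1, hfz]
    simp only [g, hinv]
    exact Int.toNat_of_nonneg (Int.emod_nonneg _ (by omega))
  have hzu : z.1 * q + F z.1 = u (i, j) n := by
    rw [hFz, ← hnz]
    exact Int.ediv_mul_add_emod _ _
  refine ⟨n, Set.mem_iUnion₂.2 ⟨z.1, z.2, ?_⟩⟩
  rw [hzu]
  have hu1 : (u (i, j) n : ℝ) ≤ k * q * x (i, j) n := Int.floor_le _
  have hu2 : k * q * x (i, j) n < u (i, j) n + 1 := Int.lt_floor_add_one _
  have hx : k * q * x (i, j) n =
      k * q * (1 / k * a n) + i * (a n / a M) + (-k * (k * q) + j) := by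
    simp only [x]; field_simp
  have hi1 : (i : ℝ) ≤ (c - 1 / k) * (k * q * a M) := Nat.floor_le hi0
  have hi2 : (c - 1 / k) * (k * q * a M) < i + 1 := Nat.lt_floor_add_one _
  have hj1 : (j : ℝ) ≤ (d + k) * (k * q) := Nat.floor_le hj0
  have hj2 : (d + k) * (k * q) < j + 1 := Nat.lt_floor_add_one _
  have hρ0 : 0 < a n / a M := div_pos (hpos n) haM
  have hρ1 : a n / a M ≤ 1 :=
    (div_le_one haM).2 (hmono (Finset.mem_range.1 hn).le)
  have hy : (c * a n + d) * (k * q) = k * q * (1 / k * a n) +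
      (c - 1 / k) * (k * q * a M) * (a n / a M) + (-k * (k * q) + (d + k) * (k * q)) := by
    field_simp; ring
  have hi3 := mul_le_mul_of_nonneg_right hi1 hρ0.le
  have hi4 := mul_lt_mul_of_pos_right hi2 hρ0
  -- In subcell units the dilation error (as $a_n\le a_M$), the translation error and the floor each
  -- lie in $[0,1)$, so the total is in $[0,3)$.
  constructor
  · rw [div_le_iff₀ hkq, hy]
    linarith
  · rw [lt_div_iff₀ hkq, hy]
    push_cast
    linarith

theorem exists_bounded_sparse_hitting (a : ℕ → ℝ) (hpos : ∀ n, 0 < a n)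
    (hgap : ∀ n, 1 ≤ a (n + 1) - a n)
    (hlog : Tendsto (fun n : ℕ => Real.log (a n) / ((n : ℝ) + 1)) atTop (𝓝 0))
    (k : ℕ) (hk : 1 ≤ k) {ε : ℝ} (hε : 0 < ε) :
    ∃ F : Set ℝ, MeasurableSet F ∧ BddAbove F ∧
      (∀ t, volume (F ∩ Set.Icc t (t + 1)) ≤ ENNReal.ofReal ε) ∧
      ∀ c d : ℝ, 1 / (k : ℝ) ≤ c → c ≤ k → -(k : ℝ) ≤ d → d ≤ k → ∃ n, c * a n + d ∈ F := by
  obtain ⟨q, hq⟩ := exists_nat_ge (18 / ε)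
  obtain ⟨F, h1, h2, h3, h4⟩ := exists_bounded_sparse_hitting_of_nat a hpos hgap hlog k (q + 2) hk
    (by omega)
  refine ⟨F, h1, h2, fun t => (h3 t).trans (ENNReal.ofReal_le_ofReal ?_), h4⟩
  rw [div_le_iff₀ hε] at hq
  rw [div_le_iff₀ (by positivity)]
  push_cast
  nlinarith

/-- Dominated convergence for series: each term vanishes for large $t$ by boundedness. -/
theorem tendsto_volume_iUnion_inter_Icc (F : ℕ → Set ℝ) (b : ℕ → ENNReal) (hb : ∑' k, b k ≠ ⊤)
    (hbdd : ∀ k, BddAbove (F k)) (hF : ∀ k t, volume (F k ∩ Set.Icc t (t + 1)) ≤ b k) :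
    Tendsto (fun t : ℝ => volume ((⋃ k, F k) ∩ Set.Icc t (t + 1))) atTop (𝓝 0) := by
  have hsum : Tendsto (fun t : ℝ => ∑' k, volume (F k ∩ Set.Icc t (t + 1))) atTop (𝓝 0) := by
    have h := tendsto_lintegral_filter_of_dominated_convergence (μ := Measure.count)
      (l := (atTop : Filter ℝ)) (F := fun t k => volume (F k ∩ Set.Icc t (t + 1)))
      (f := fun _ : ℕ => 0) b (Eventually.of_forall fun t => measurable_from_nat)
      (Eventually.of_forall fun t => Eventually.of_forall fun k => hF k t)
      (by rwa [lintegral_count]) (Eventually.of_forall fun k => ?_)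
    · simpa [lintegral_count] using h
    · obtain ⟨R, hR⟩ := hbdd k
      refine tendsto_const_nhds.congr' ?_
      filter_upwards [eventually_gt_atTop R] with t ht
      have : F k ∩ Set.Icc t (t + 1) = ∅ :=
        Set.eq_empty_of_forall_notMem fun x hx => by linarith [hR hx.1, hx.2.1]
      simp [this]
  refine tendsto_of_tendsto_of_tendsto_of_le_of_le tendsto_const_nhds hsum
    (fun _ => zero_le) fun t => ?_
  simp only [Set.iUnion_inter]
  exact measure_iUnion_le _

/-- The sequence `a₁, a₂, …` is written as `a 0, a 1, …`, so that `a n` is the `(n + 1)`-st term. -/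
theorem theorem2p4 (a : ℕ → ℝ) (hpos : ∀ n : ℕ, 0 < a n)
    (hgap : ∀ n : ℕ, 1 ≤ a (n + 1) - a n)
    (hlog : Tendsto (fun n : ℕ => Real.log (a n) / ((n : ℝ) + 1)) atTop (𝓝 0)) :
    ∃ E : Set ℝ, MeasurableSet E ∧
      Tendsto (fun t : ℝ => volume (E ∩ Set.Icc t (t + 1))) atTop (𝓝 1) ∧
      ¬ ∃ T : Set ℝ, IsSimilarCopy T (Set.range a) ∧ T ⊆ E := by
  choose F hFm hFb hFv hFh using fun k : ℕ =>
    exists_bounded_sparse_hitting a hpos hgap hlog (k + 1) (by omega)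
      (ε := (1 / 2) ^ k) (by positivity)
  have hsum : ∑' k : ℕ, ENNReal.ofReal ((1 / 2) ^ k) ≠ ⊤ :=
    (summable_geometric_two).tsum_ofReal_ne_top
  have hlim := tendsto_volume_iUnion_inter_Icc F _ hsum hFb hFv
  refine ⟨Set.Ioi 0 \ ⋃ k, F k, measurableSet_Ioi.diff (MeasurableSet.iUnion hFm), ?_, ?_⟩
  · have hlow : Tendsto (fun t : ℝ => 1 - volume ((⋃ k, F k) ∩ Set.Icc t (t + 1))) atTop (𝓝 1) := by
      simpa using ENNReal.Tendsto.sub (tendsto_const_nhds (x := (1 : ENNReal))) hlim (by simp)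
    refine tendsto_of_tendsto_of_tendsto_of_le_of_le' hlow tendsto_const_nhds ?_ ?_
    · filter_upwards [eventually_gt_atTop 0] with t ht
      rw [tsub_le_iff_right]
      calc (1 : ENNReal) = volume (Set.Icc t (t + 1)) := by simp
        _ ≤ volume ((Set.Ioi 0 \ ⋃ k, F k) ∩ Set.Icc t (t + 1) ∪
            (⋃ k, F k) ∩ Set.Icc t (t + 1)) := by
          refine measure_mono fun x hx => ?_
          by_cases h : x ∈ ⋃ k, F k
          · exact Or.inr ⟨h, hx⟩
          · exact Or.inl ⟨⟨ht.trans_le hx.1, h⟩, hx⟩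
        _ ≤ _ := measure_union_le _ _
    · refine Eventually.of_forall fun t => ?_
      calc _ ≤ volume (Set.Icc t (t + 1)) := measure_mono Set.inter_subset_right
        _ = 1 := by simp
  · rintro ⟨T, ⟨c, d, hc, rfl⟩, hT⟩
    have hmem : ∀ n, c * a n + d ∈ Set.Ioi 0 \ ⋃ k, F k := fun n =>
      hT ⟨a n, Set.mem_range_self n, rfl⟩
    rcases lt_or_gt_of_ne hc with hneg | hcpos
    · have hge : ∀ n : ℕ, (n : ℝ) ≤ a n := by
        intro n
        induction n with
        | zero => simpa using (hpos 0).le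
        | succ n ih => push_cast; linarith [hgap n]
      obtain ⟨n, hn⟩ := exists_nat_ge (d / -c)
      rw [div_le_iff₀ (by linarith)] at hn
      have h0 : 0 < c * a n + d := (hmem n).1
      nlinarith [hge n]
    · obtain ⟨k, hk⟩ := exists_nat_ge (max (max c (1 / c)) |d|)
      obtain ⟨⟨h1, h2⟩, h3⟩ : (c ≤ k ∧ 1 / c ≤ k) ∧ |d| ≤ k := by
        simpa only [max_le_iff] using hk
      obtain ⟨h4, h5⟩ := abs_le.1 h3
      obtain ⟨n, hn⟩ := hFh k c d
        (by
          rw [div_le_iff₀ hcpos] at h2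
          rw [div_le_iff₀ (by positivity)]
          push_cast
          nlinarith)
        (by push_cast; linarith) (by push_cast; linarith) (by push_cast; linarith)
      exact (hmem n).2 (Set.mem_iUnion.2 ⟨k, hn⟩)
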